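/- Let $\mathbf{p}=(p_1,\dots,p_k)$ be a probability distribution and $C(\mathbf{p})=\sum_x p_x^2$ its collision probability. Given a real number $n\ge 0$ (the intended number of users), $\varepsilon_{\mathrm{rel}}\in(0,1]$, $\delta\in(0,1)$, $\alpha>0$ and $\beta\in(0,1]$, put $$a=\Big\lceil 8\log\tfrac1\delta\Big\rceil,\quad b=\Big\lceil \tfrac{20}{\varepsilon_{\mathrm{rel}}^2}\Big\rceil,\quad g=ab,\quad m=\frac ng,\quad r=\Big\lceil 6\Big(\tfrac{e^\alpha+1}{e^\alpha-1}\Big)^2\log\tfrac4\beta\Big\rceil .$$ The mechanism works as follows. The server draws independent group sizes $N_1,\dots,N_g\sim\mathrm{Poisson}(m)$, lets group $j$ consist of $N_j$ users, and sends to all users one random hash function $h:\{0,1\}^*\to\{-1,+1\}$, whose values on distinct strings are independent and uniform. Each user $i$ in group $j_i$ independently draws a uniform salt $s_i\in\{1,\dots,r\}$ and a sample $x_i\sim\mathbf{p}$, and sends $v_i=h(\langle j_i,s_i,x_i\rangle)$, where $\langle\cdot,\cdot,\cdot\rangle$ is an injective encoding of triples as bit strings. The group sizes, $h$, the salts and the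 samples are independent. The server computes $V_j=\sum_{i\text{ in group }j}v_i$ and $C_j=r(V_j^2-m)/m^2$ for each group $j$, partitions the $g$ groups into $a$ supergroups of $b$ groups each, lets $\bar C_\ell$ be the mean of the $C_j$ over supergroup $\ell$, and outputs the median $\hat C$ of $\bar C_1,\dots,\bar C_a$. Then: (1) The sample complexity of the mechanism is $n$: the number of users $N=\sum_j N_j$ satisfies $\mathbb{E}[N]=n$. (2) For all $\beta_0,\delta_0<1$ there is a constant $K>0$, depending only on $\beta_0$ and $\delta_0$, such that whenever $\beta\le\beta_0$, $\delta\le\delta_0$ and $$n\ \ge\ K\Big(\frac{e^\alpha+1}{e^\alpha-1}\Big)^2\frac{\log\frac1\beta\,\log\frac1\delta}{C(\mathbf{p})\,\varepsilon_{\mathrm{rel}}^2},$$ the output satisfies $|\hat C-C(\mathbf{p})|\le\varepsilon_{\mathrm{rel}}\,C(\mathbf{p})$ with probability at least $1-\delta$. -/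

import Mathlib

open MeasureTheory ProbabilityTheory
open scoped NNReal

noncomputable section

namespace CollisionMech

/-- The collision probability `C(p) = ∑ᵢ pᵢ²` of a distribution `p = (p₁, …, p_k)`. -/
def collisionProb {k : ℕ} (p : PMF (Fin k)) : ℝ := ∑ i, (p i).toReal ^ 2

/-- The input parameters of the mechanism: expected number of users `n`, desired relative error
`ε`, failure probability `δ`, privacy parameters `α` and `β`. The degenerate values `α = 0`
(infinitely many salts) and `δ = 1` (no groups at all) are left out. -/
structure Params where
  n : ℝ≥0
  ε : ℝ
  δ : ℝ
  α : ℝ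
  β : ℝ
  ε_pos : 0 < ε
  ε_le : ε ≤ 1
  δ_pos : 0 < δ
  δ_lt : δ < 1
  α_pos : 0 < α
  β_pos : 0 < β
  β_le : β ≤ 1

namespace Params

variable (P : Params)

/-- The number of supergroups, `8 log (1/δ)`, rounded up. -/
def a : ℕ := ⌈8 * Real.log (1 / P.δ)⌉₊

/-- The number of groups in each supergroup, `20 / ε²`, rounded up. -/
def b : ℕ := ⌈20 / P.ε ^ 2⌉₊

/-- The number of groups, `g = a b` (up to the rounding this is `160 log (1/δ) / ε²`). -/
def g : ℕ := P.a * P.b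

/-- The expected size `m = n / g` of a group. -/
def m : ℝ≥0 := P.n / P.g

/-- The factor `(e^α + 1) / (e^α - 1)`. -/
def privFactor : ℝ := (Real.exp P.α + 1) / (Real.exp P.α - 1)

/-- The number of salts, `6 ((e^α + 1) / (e^α - 1))² log (4/β)`, rounded up. -/
def r : ℕ := ⌈6 * P.privFactor ^ 2 * Real.log (4 / P.β)⌉₊

theorem a_pos : 0 < P.a := by
  have h : 1 < 1 / P.δ := (one_lt_div P.δ_pos).2 P.δ_lt
  exact Nat.ceil_pos.2 (mul_pos (by norm_num) (Real.log_pos h))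

theorem privFactor_pos : 0 < P.privFactor := by
  have h : 1 < Real.exp P.α := Real.one_lt_exp_iff.2 P.α_pos
  exact div_pos (by linarith) (by linarith)

theorem r_pos : 0 < P.r := by
  have h : 1 < 4 / P.β := (one_lt_div P.β_pos).2 (by linarith [P.β_le])
  exact Nat.ceil_pos.2
    (mul_pos (mul_pos (by norm_num) (pow_pos P.privFactor_pos 2)) (Real.log_pos h))

instance : NeZero P.a := ⟨P.a_pos.ne'⟩

instance : NeZero P.r := ⟨P.r_pos.ne'⟩

end Params

/-- The median of `a ≥ 1` real numbers: the middle entry of the sorted tuple if `a` is odd, the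
average of the two middle entries if `a` is even. -/
def median {a : ℕ} [NeZero a] (v : Fin a → ℝ) : ℝ :=
  (v (Tuple.sort v ⟨(a - 1) / 2, by have := NeZero.pos a; omega⟩) +
    v (Tuple.sort v ⟨a / 2, by have := NeZero.pos a; omega⟩)) / 2

/-- The outcomes of all the random choices: the group sizes `N_j`, the hash function
`h : {0,1}* → {-1,+1}`, and the salts and the samples of the users. The users are named by pairs
`(j, i)`; group `j` consists of the users `(j, 0), …, (j, N_j - 1)`, and the salts and samples of
the pairs with `i ≥ N_j` are never used. -/
abbrev Outcome (P : Params) (k : ℕ) : Type :=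
  (Fin P.g → ℕ) × (List Bool → ℤˣ) × (Fin P.g × ℕ → Fin P.r) × (Fin P.g × ℕ → Fin k)

/-- The joint law of the random choices: they are all independent, the group sizes are
`Poisson(m)`, the hash values of distinct strings are uniform on `{-1,+1}`, the salts are uniform,
and the samples have distribution `p`. -/
def law (P : Params) {k : ℕ} (p : PMF (Fin k)) : Measure (Outcome P k) :=
  (Measure.pi fun _ : Fin P.g => poissonMeasure P.m).prod
    ((Measure.infinitePi fun _ : List Bool => (PMF.uniformOfFintype ℤˣ).toMeasure).prod
      ((Measure.infinitePi fun _ : Fin P.g × ℕ => (PMF.uniformOfFintype (Fin P.r)).toMeasure).prod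
        (Measure.infinitePi fun _ : Fin P.g × ℕ => p.toMeasure)))

variable (P : Params) {k : ℕ}

/-- The number of users who participate. -/
def numUsers (ω : Outcome P k) : ℕ := ∑ j, ω.1 j

/-- The hash value `h(⟨j, s, x⟩)` sent by user `u = (j, i)` with salt `s` and sample `x`, where
`enc` is the encoding `⟨·, ·, ·⟩` of triples as bit strings. -/
def hashValue (enc : Fin P.g × Fin P.r × Fin k → List Bool) (ω : Outcome P k)
    (u : Fin P.g × ℕ) : ℤˣ :=
  ω.2.1 (enc (u.1, ω.2.2.1 u, ω.2.2.2 u))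

/-- The sum `V_j` of the hash values in group `j`. -/
def groupSum (enc : Fin P.g × Fin P.r × Fin k → List Bool) (ω : Outcome P k) (j : Fin P.g) : ℝ :=
  ∑ i ∈ Finset.range (ω.1 j), ((hashValue P enc ω (j, i) : ℤ) : ℝ)

/-- The estimate `C_j = r (V_j² - m) / m²` of group `j`. -/
def groupEstimate (enc : Fin P.g × Fin P.r × Fin k → List Bool) (ω : Outcome P k)
    (j : Fin P.g) : ℝ :=
  P.r * (groupSum P enc ω j ^ 2 - P.m) / (P.m : ℝ) ^ 2

/-- The mean `C̄_ℓ` of the estimates of the groups in supergroup `ℓ`, where `sg j` is the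
supergroup of group `j`. -/
def supergroupMean (enc : Fin P.g × Fin P.r × Fin k → List Bool) (sg : Fin P.g → Fin P.a)
    (ω : Outcome P k) (l : Fin P.a) : ℝ :=
  1 / (P.b : ℝ) * ∑ j with sg j = l, groupEstimate P enc ω j

/-- The output `Ĉ` of the mechanism: the median of the supergroup means. -/
def estimate (enc : Fin P.g × Fin P.r × Fin k → List Bool) (sg : Fin P.g → Fin P.a)
    (ω : Outcome P k) : ℝ :=
  median (supergroupMean P enc sg ω)

end CollisionMech

end

/-!
The number of users is a sum of `g` Poisson variables of mean `m = n / g`, which gives its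
expectation (`numUsers_integral`).

For the accuracy, fix a group. Given the hash function `η`, the values sent by its users are
independent signs with mean `t = ∑ q_y η_y`, where `y` runs over the pairs of a salt and a sample
and `q_y = p_x / r`. The moments of a sum of `n` such signs are polynomials in `t` and in the
falling factorials of `n` (`moments_sum_signs`). The `d`-th factorial moment of a Poisson variable is
`m ^ d` (`integral_poisson_descFactorial`), and `t` is a Rademacher sum with `E t² = c := C(p) / r`
and `E t⁴ ≤ 3 c²` (`moments_rademacher`). Hence `E V² = m + m² c` and
`Var V² ≤ m + 4 m² c + 2 (m + m² c)²` (`group_moments`), so that the estimate of a group has mean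
`C(p)` and, as soon as `m C(p) ≥ 5 r`, variance at most `5 C(p)²` (`groupEstimate_moments`).

Different groups hash different strings, because the encoding is injective and the triples carry
the number of the group; this makes their estimates independent although they share one hash
function (`iIndepFun_groupEstimate`). By Chebyshev's inequality the mean over a supergroup of
`b ≥ 20 / ε²` groups is off by more than `ε C(p)` with probability at most `1/4` (`mean_tail`). If the
median is off, so are at least half of the `a` independent means, which by an exponential moment
bound has probability at most `(√3 / 2) ^ a ≤ exp (-a / 8) ≤ δ` (`median_tail`).
Finally `m C(p) ≥ 5 r` is what the lower bound on `n` says, up to the roundings in `a`, `b` and `r`,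
whose cost is bounded because `β` and `δ` stay away from `1` (`exists_const_group_size`).
-/

open MeasureTheory ProbabilityTheory
open scoped NNReal

namespace CollisionMech

/-! ### Independence of families of random variables -/

/-- Blocks of an independent family are independent. -/
theorem iIndepFun_curry {ι Ω : Type*} {mΩ : MeasurableSpace Ω} {μ : Measure Ω} {κ : ι → Type*}
    {𝓧 : (i : ι) → κ i → Type*} {m𝓧 : ∀ i j, MeasurableSpace (𝓧 i j)}
    {X : (i : ι) → (j : κ i) → Ω → 𝓧 i j} (hX : ∀ i j, Measurable (X i j))
    (h : iIndepFun (fun (p : (i : ι) × κ i) ω ↦ X p.1 p.2 ω) μ) :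
    iIndepFun (fun i ω j ↦ X i j ω) μ := by
  have := h.isProbabilityMeasure
  have : ∀ i j, IsProbabilityMeasure (μ.map (X i j)) :=
    fun i j ↦ Measure.isProbabilityMeasure_map (hX i j).aemeasurable
  have hblock : ∀ i, iIndepFun (X i) μ := fun i ↦
    h.precomp (g := fun j : κ i ↦ (⟨i, j⟩ : (i : ι) × κ i)) fun _ _ h ↦ by simpa using h
  rw [iIndepFun_iff_map_fun_eq_infinitePi_map (by fun_prop)]
  have key := congrArg (Measure.map (MeasurableEquiv.piCurry 𝓧))
    ((iIndepFun_iff_map_fun_eq_infinitePi_map (by fun_prop)).1 h)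
  rw [Measure.map_map (by fun_prop) (by fun_prop),
    Measure.infinitePi_map_piCurry (fun i j ↦ μ.map (X i j))] at key
  refine Eq.trans ?_ (key.trans ?_)
  · rfl
  · congrm Measure.infinitePi fun i ↦ ?_
    rw [(iIndepFun_iff_map_fun_eq_infinitePi_map (by fun_prop)).1 (hblock i)]

/-- Pairing two independent families, defined on the two factors of a product space, gives an
independent family of pairs. -/
theorem iIndepFun_prodMk {ι Ω Ω' α β : Type*} {mΩ : MeasurableSpace Ω}
    {mΩ' : MeasurableSpace Ω'} {mα : MeasurableSpace α} {mβ : MeasurableSpace β}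
    {μ : Measure Ω} {ν : Measure Ω'} {X : ι → Ω → α} {Y : ι → Ω' → β}
    (hX : ∀ i, Measurable (X i)) (hY : ∀ i, Measurable (Y i))
    (iX : iIndepFun X μ) (iY : iIndepFun Y ν) :
    iIndepFun (fun i (ω : Ω × Ω') ↦ (X i ω.1, Y i ω.2)) (μ.prod ν) := by
  have := iX.isProbabilityMeasure
  have := iY.isProbabilityMeasure
  have pX : ∀ i, IsProbabilityMeasure (μ.map (X i)) :=
    fun i ↦ Measure.isProbabilityMeasure_map (hX i).aemeasurable
  have pY : ∀ i, IsProbabilityMeasure (ν.map (Y i)) :=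
    fun i ↦ Measure.isProbabilityMeasure_map (hY i).aemeasurable
  rw [iIndepFun_iff_finset]
  intro s
  have hXs := (iIndepFun_iff_map_fun_eq_pi_map (f := s.restrict X)
    fun i ↦ (hX i).aemeasurable).1 (iIndepFun_iff_finset.1 iX s)
  have hYs := (iIndepFun_iff_map_fun_eq_pi_map (f := s.restrict Y)
    fun i ↦ (hY i).aemeasurable).1 (iIndepFun_iff_finset.1 iY s)
  have mXs : Measurable (fun ω (i : s) ↦ s.restrict X i ω) :=
    measurable_pi_lambda _ fun i ↦ hX i
  have mYs : Measurable (fun ω (i : s) ↦ s.restrict Y i ω) :=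
    measurable_pi_lambda _ fun i ↦ hY i
  have mp := measurePreserving_arrowProdEquivProdArrow α β s
    (fun i ↦ μ.map (X i)) (fun i ↦ ν.map (Y i))
  rw [iIndepFun_iff_map_fun_eq_pi_map fun i ↦ by
    exact Measurable.aemeasurable (((hX i).comp measurable_fst).prodMk
      ((hY i).comp measurable_snd))]
  have mp' : Measurable (fun (ω : Ω × Ω') (i : s) ↦ (X i ω.1, Y i ω.2)) :=
    measurable_pi_lambda _ fun i ↦
      ((hX i).comp measurable_fst).prodMk ((hY i).comp measurable_snd)
  have e : ∀ i : s, Measure.map (s.restrict (fun i (ω : Ω × Ω') ↦ (X i ω.1, Y i ω.2)) i)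
      (μ.prod ν) = (μ.map (X i)).prod (ν.map (Y i)) := fun i ↦ by
    rw [Measure.map_prod_map _ _ (hX i) (hY i)]; rfl
  simp_rw [e]
  rw [← (MeasurableEquiv.arrowProdEquivProdArrow α β s).map_measurableEquiv_injective.eq_iff,
    mp.map_eq]
  refine (Measure.map_map (MeasurableEquiv.measurable _) mp').trans
    (Eq.trans ?_ (congrArg₂ Measure.prod hXs hYs))
  rw [Measure.map_prod_map _ _ mXs mYs]
  rfl

/-! ### Moments of sums of independent signs -/

section Moments

variable {Ω : Type*} {mΩ : MeasurableSpace Ω} {μ : Measure Ω}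

theorem integrable_of_abs_le [IsFiniteMeasure μ] {X : Ω → ℝ} (hX : Measurable X) {c : ℝ}
    (h : ∀ ω, |X ω| ≤ c) : Integrable X μ :=
  .of_bound hX.aestronglyMeasurable c (.of_forall h)

theorem abs_sum_range_le {v : ℕ → ℝ} (h : ∀ i, v i ^ 2 = 1) (n : ℕ) :
    |∑ i ∈ Finset.range n, v i| ≤ n := by
  refine (Finset.abs_sum_le_sum_abs _ _).trans ?_
  have : ∀ i, |v i| = 1 := fun i ↦ by
    rw [← sq_eq_sq₀ (abs_nonneg _) zero_le_one, sq_abs, h, one_pow]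
  simp [this]

/-- The first four moments of a sum of `n` independent signs of mean `t`. The coefficient of the
`d`-th falling factorial of `n` collects the index tuples with `d` distinct values. -/
theorem moments_sum_signs {v : ℕ → Ω → ℝ} (hv : ∀ i, Measurable (v i)) (hi : iIndepFun v μ)
    (hsq : ∀ i ω, v i ω ^ 2 = 1) {t : ℝ} (ht : ∀ i, ∫ ω, v i ω ∂μ = t) (n : ℕ) :
    ∫ ω, ∑ i ∈ Finset.range n, v i ω ∂μ = n * t ∧
    ∫ ω, (∑ i ∈ Finset.range n, v i ω) ^ 2 ∂μ = n + n * (n - 1) * t ^ 2 ∧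
    ∫ ω, (∑ i ∈ Finset.range n, v i ω) ^ 3 ∂μ =
      n * t + n * (n - 1) * (3 * t) + n * (n - 1) * (n - 2) * t ^ 3 ∧
    ∫ ω, (∑ i ∈ Finset.range n, v i ω) ^ 4 ∂μ =
      n + n * (n - 1) * (4 * t ^ 2 + 3) + n * (n - 1) * (n - 2) * (6 * t ^ 2) +
        n * (n - 1) * (n - 2) * (n - 3) * t ^ 4 := by
  have := hi.isProbabilityMeasure
  induction n with
  | zero => simp
  | succ n ih =>
    obtain ⟨h1, h2, h3, h4⟩ := ih
    set S : Ω → ℝ := fun ω ↦ ∑ i ∈ Finset.range n, v i ω with hS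
    have mS : Measurable S := by fun_prop
    have bS : ∀ ω, |S ω| ≤ n := fun ω ↦ abs_sum_range_le (fun i ↦ hsq i ω) n
    have iS : ∀ k : ℕ, Integrable (fun ω ↦ S ω ^ k) μ := fun k ↦
      integrable_of_abs_le (by fun_prop) (c := (n : ℝ) ^ k) fun ω ↦ by
        rw [abs_pow]; exact pow_le_pow_left₀ (abs_nonneg _) (bS ω) k
    have bv : ∀ ω, |v n ω| ≤ 1 := fun ω ↦ (sq_le_one_iff_abs_le_one _).1 (hsq n ω).le
    have iv : Integrable (v n) μ := integrable_of_abs_le (hv n) bv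
    have ind : IndepFun S (v n) μ := by
      have := hi.indepFun_finsetSum_of_notMem hv (s := Finset.range n) (i := n) (by simp)
      convert this using 1
      ext ω; simp [hS]
    have indk : ∀ k : ℕ, IndepFun (fun ω ↦ S ω ^ k) (v n) μ := fun k ↦
      ind.comp (measurable_id.pow_const k) measurable_id
    have iSv : ∀ k : ℕ, Integrable (fun ω ↦ S ω ^ k * v n ω) μ := fun k ↦
      (indk k).integrable_mul (iS k) iv
    have eSv : ∀ k : ℕ, ∫ ω, S ω ^ k * v n ω ∂μ = (∫ ω, S ω ^ k ∂μ) * t := fun k ↦ by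
      rw [(indk k).integral_fun_mul_eq_mul_integral (iS k).1 iv.1, ht]
    have i1 : Integrable S μ := by simpa using iS 1
    have e1 := eSv 1
    have e2 := eSv 2
    have e3 := eSv 3
    have is1 := iSv 1
    simp only [pow_one] at e1 is1
    have s1 : ∀ ω, ∑ i ∈ Finset.range (n + 1), v i ω = S ω + v n ω := fun ω ↦
      Finset.sum_range_succ _ _
    have s2 : ∀ ω, (∑ i ∈ Finset.range (n + 1), v i ω) ^ 2 = S ω ^ 2 + 2 * (S ω * v n ω) + 1 :=
      fun ω ↦ by rw [s1, ← hsq n ω]; ring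
    have s3 : ∀ ω, (∑ i ∈ Finset.range (n + 1), v i ω) ^ 3 =
        S ω ^ 3 + 3 * (S ω ^ 2 * v n ω) + 3 * S ω + v n ω := fun ω ↦ by
      rw [s1]
      linear_combination (3 * S ω + v n ω) * hsq n ω
    have s4 : ∀ ω, (∑ i ∈ Finset.range (n + 1), v i ω) ^ 4 =
        S ω ^ 4 + 4 * (S ω ^ 3 * v n ω) + 6 * S ω ^ 2 + 4 * (S ω * v n ω) + 1 := fun ω ↦ by
      rw [s1]
      linear_combination (6 * S ω ^ 2 + 4 * S ω * v n ω + v n ω ^ 2 + 1) * hsq n ω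
    refine ⟨?_, ?_, ?_, ?_⟩
    · simp_rw [s1]
      rw [integral_add i1 iv, h1, ht]; push_cast; ring
    · simp_rw [s2]
      rw [integral_add ((iS 2).fun_add (is1.const_mul 2)) (integrable_const _),
        integral_add (iS 2) (is1.const_mul 2), integral_const_mul, e1, h1, h2]
      simp; ring
    · simp_rw [s3]
      rw [integral_add (((iS 3).fun_add ((iSv 2).const_mul 3)).fun_add (i1.const_mul 3)) iv,
        integral_add ((iS 3).fun_add ((iSv 2).const_mul 3)) (i1.const_mul 3),
        integral_add (iS 3) ((iSv 2).const_mul 3), integral_const_mul, integral_const_mul,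
        e2, h1, h2, h3, ht]
      push_cast; ring
    · simp_rw [s4]
      rw [integral_add ((((iS 4).fun_add ((iSv 3).const_mul 4)).fun_add ((iS 2).const_mul 6)).fun_add
          (is1.const_mul 4)) (integrable_const _),
        integral_add (((iS 4).fun_add ((iSv 3).const_mul 4)).fun_add ((iS 2).const_mul 6))
          (is1.const_mul 4),
        integral_add ((iS 4).fun_add ((iSv 3).const_mul 4)) ((iS 2).const_mul 6),
        integral_add (iS 4) ((iSv 3).const_mul 4), integral_const_mul, integral_const_mul,
        integral_const_mul, e3, e1, h1, h2, h3, h4]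
      simp; ring

/-- The second and fourth moments of a linear combination of independent Rademacher variables. -/
theorem moments_rademacher {ι : Type*} {ε : ι → Ω → ℝ} (hε : ∀ i, Measurable (ε i))
    (hi : iIndepFun ε μ) (hsq : ∀ i ω, ε i ω ^ 2 = 1) (h0 : ∀ i, ∫ ω, ε i ω ∂μ = 0)
    (q : ι → ℝ) (s : Finset ι) :
    ∫ ω, (∑ i ∈ s, q i * ε i ω) ^ 2 ∂μ = ∑ i ∈ s, q i ^ 2 ∧
    ∫ ω, (∑ i ∈ s, q i * ε i ω) ^ 4 ∂μ ≤ 3 * (∑ i ∈ s, q i ^ 2) ^ 2 := by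
  have := hi.isProbabilityMeasure
  classical
  induction s using Finset.induction_on with
  | empty => simp
  | insert a s has ih =>
    obtain ⟨h2, h4⟩ := ih
    set S : Ω → ℝ := fun ω ↦ ∑ i ∈ s, q i * ε i ω with hS
    have mS : Measurable S := by fun_prop
    have bε : ∀ i ω, |ε i ω| ≤ 1 := fun i ω ↦ (sq_le_one_iff_abs_le_one _).1 (hsq i ω).le
    have bS : ∀ ω, |S ω| ≤ ∑ i ∈ s, |q i| := fun ω ↦
      (Finset.abs_sum_le_sum_abs _ _).trans (Finset.sum_le_sum fun i _ ↦ by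
        rw [abs_mul]; exact mul_le_of_le_one_right (abs_nonneg _) (bε i ω))
    have iS : ∀ k : ℕ, Integrable (fun ω ↦ S ω ^ k) μ := fun k ↦
      integrable_of_abs_le (by fun_prop) (c := (∑ i ∈ s, |q i|) ^ k) fun ω ↦ by
        rw [abs_pow]; exact pow_le_pow_left₀ (abs_nonneg _) (bS ω) k
    have iε : Integrable (ε a) μ := integrable_of_abs_le (hε a) (bε a)
    have ind : IndepFun S (ε a) μ := by
      have hφ : Measurable (fun x : s → ℝ ↦ ∑ i : s, q i * x i) := by fun_prop
      have hψ : Measurable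
          (fun x : ({a} : Finset ι) → ℝ ↦ x ⟨a, Finset.mem_singleton_self a⟩) :=
        measurable_pi_apply _
      have h := (hi.indepFun_finset s {a} (by simpa using has) hε).comp hφ hψ
      have hS' : S = (fun x : s → ℝ ↦ ∑ i : s, q i * x i) ∘ fun ω i ↦ ε i ω := by
        ext ω
        exact (Finset.sum_coe_sort s fun i ↦ q i * ε i ω).symm
      rw [hS']
      exact h
    have indk : ∀ k : ℕ, IndepFun (fun ω ↦ S ω ^ k) (ε a) μ := fun k ↦
      ind.comp (measurable_id.pow_const k) measurable_id
    have iSε : ∀ k : ℕ, Integrable (fun ω ↦ S ω ^ k * ε a ω) μ := fun k ↦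
      (indk k).integrable_mul (iS k) iε
    have eSε : ∀ k : ℕ, ∫ ω, S ω ^ k * ε a ω ∂μ = 0 := fun k ↦ by
      rw [(indk k).integral_fun_mul_eq_mul_integral (iS k).1 iε.1, h0, mul_zero]
    have is1 := iSε 1
    have e1 := eSε 1
    simp only [pow_one] at is1 e1
    have s1 : ∀ ω, ∑ i ∈ insert a s, q i * ε i ω = q a * ε a ω + S ω := fun ω ↦
      Finset.sum_insert has
    have s2 : ∀ ω, (∑ i ∈ insert a s, q i * ε i ω) ^ 2 =
        S ω ^ 2 + 2 * q a * (S ω * ε a ω) + q a ^ 2 := fun ω ↦ by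
      rw [s1]; linear_combination q a ^ 2 * hsq a ω
    have s4 : ∀ ω, (∑ i ∈ insert a s, q i * ε i ω) ^ 4 =
        S ω ^ 4 + 4 * q a * (S ω ^ 3 * ε a ω) + 6 * q a ^ 2 * S ω ^ 2 +
          4 * q a ^ 3 * (S ω * ε a ω) + q a ^ 4 := fun ω ↦ by
      rw [s1]
      linear_combination (6 * q a ^ 2 * S ω ^ 2 + 4 * q a ^ 3 * S ω * ε a ω +
        q a ^ 4 * (ε a ω ^ 2 + 1)) * hsq a ω
    rw [Finset.sum_insert has]
    refine ⟨?_, ?_⟩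
    · simp_rw [s2]
      rw [integral_add ((iS 2).fun_add (is1.const_mul _)) (integrable_const _),
        integral_add (iS 2) (is1.const_mul _), integral_const_mul, e1, h2]
      simp; ring
    · simp_rw [s4]
      rw [integral_add ((((iS 4).fun_add ((iSε 3).const_mul _)).fun_add ((iS 2).const_mul _)).fun_add
          (is1.const_mul _)) (integrable_const _),
        integral_add (((iS 4).fun_add ((iSε 3).const_mul _)).fun_add ((iS 2).const_mul _))
          (is1.const_mul _),
        integral_add ((iS 4).fun_add ((iSε 3).const_mul _)) ((iS 2).const_mul _),
        integral_add (iS 4) ((iSε 3).const_mul _), integral_const_mul, integral_const_mul,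
        integral_const_mul, eSε 3, e1, h2]
      simp
      nlinarith [sq_nonneg (q a ^ 2)]

end Moments

/-! ### Factorial moments of the Poisson distribution -/

theorem cast_descFactorial_succ (n k : ℕ) :
    (n.descFactorial (k + 1) : ℝ) = (n - k) * n.descFactorial k := by
  rw [Nat.descFactorial_succ, Nat.cast_mul]
  rcases le_or_gt k n with h | h
  · rw [Nat.cast_sub h]
  · simp [Nat.descFactorial_of_lt h]

/-- The `k`-th factorial moment of the Poisson distribution with parameter `m` is `m ^ k`. -/
theorem hasSum_poisson_descFactorial (m : ℝ≥0) (k : ℕ) :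
    HasSum (fun n : ℕ ↦ Real.exp (-m) * m ^ n / n.factorial * (n.descFactorial k : ℝ))
      ((m : ℝ) ^ k) := by
  rw [← hasSum_nat_add_iff' k, Finset.sum_eq_zero, sub_zero]
  · have e : ∀ n : ℕ, Real.exp (-m) * m ^ (n + k) / (n + k).factorial *
        ((n + k).descFactorial k : ℝ) = m ^ k * (Real.exp (-m) * m ^ n / n.factorial) := by
      intro n
      have h := Nat.factorial_mul_descFactorial (Nat.le_add_left k n)
      rw [Nat.add_sub_cancel] at h
      have h' : (n.factorial : ℝ) * (n + k).descFactorial k = (n + k).factorial := by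
        exact_mod_cast h
      have h0 : (n.factorial : ℝ) ≠ 0 := by positivity
      have h1 : ((n + k).factorial : ℝ) ≠ 0 := by positivity
      rw [div_mul_eq_mul_div, mul_div_assoc', div_eq_div_iff h1 h0, ← h']
      ring
    simp_rw [e]
    simpa using (hasSum_one_poissonMeasure m).mul_left ((m : ℝ) ^ k)
  · intro i hi
    simp [Nat.descFactorial_of_lt (Finset.mem_range.1 hi)]

theorem integrable_poisson_descFactorial (m : ℝ≥0) (k : ℕ) :
    Integrable (fun n : ℕ ↦ (n.descFactorial k : ℝ)) (poissonMeasure m) := by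
  rw [integrable_poissonMeasure_iff]
  simpa using (hasSum_poisson_descFactorial m k).summable

theorem integral_poisson_descFactorial (m : ℝ≥0) (k : ℕ) :
    ∫ n : ℕ, (n.descFactorial k : ℝ) ∂(poissonMeasure m) = (m : ℝ) ^ k := by
  rw [integral_poissonMeasure]
  simpa using (hasSum_poisson_descFactorial m k).tsum_eq

/-- A sum with a random number of terms is measurable. -/
theorem measurable_sum_range {Ω : Type*} {mΩ : MeasurableSpace Ω} {N : Ω → ℕ}
    (hN : Measurable N) {v : ℕ → Ω → ℝ} (hv : ∀ i, Measurable (v i)) :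
    Measurable fun ω ↦ ∑ i ∈ Finset.range (N ω), v i ω := by
  have h : Measurable fun p : ℕ × Ω ↦ ∑ i ∈ Finset.range p.1, v i p.2 :=
    measurable_from_prod_countable_right fun n ↦
      Finset.measurable_sum (Finset.range n) fun i _ ↦ hv i
  exact h.comp (hN.prodMk measurable_id)

theorem integrable_poisson_pow_four (m : ℝ≥0) :
    Integrable (fun n : ℕ ↦ (n : ℝ) ^ 4) (poissonMeasure m) := by
  have h := (((integrable_poisson_descFactorial m 1).fun_add
    ((integrable_poisson_descFactorial m 2).const_mul 7)).fun_add
    ((integrable_poisson_descFactorial m 3).const_mul 6)).fun_add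
    (integrable_poisson_descFactorial m 4)
  refine h.congr (.of_forall fun n ↦ ?_)
  simp only [cast_descFactorial_succ, Nat.descFactorial_zero]
  simp
  ring

/-! ### Moments of a Poisson number of hashed signs -/

section GroupMoments

variable {Θ H B : Type*} {mΘ : MeasurableSpace Θ} {mH : MeasurableSpace H}
  {mB : MeasurableSpace B} {ρ : Measure Θ} {ν : Measure H} {A : Measure B}
  [IsProbabilityMeasure ρ] [IsProbabilityMeasure ν] [IsProbabilityMeasure A]
  {N : Θ → ℕ} {m : ℝ≥0} {v : ℕ → H × B → ℝ} {t : H → ℝ} {c : ℝ}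

theorem measurable_mean_sign (hv : ∀ i, Measurable (v i))
    (ht : ∀ i η, ∫ b, v i (η, b) ∂A = t η) : Measurable t := by
  have h := ((hv 0).stronglyMeasurable.integral_prod_right' (ν := A)).measurable
  simpa only [ht] using h

theorem abs_mean_sign_le (hsq : ∀ i x, v i x ^ 2 = 1)
    (ht : ∀ i η, ∫ b, v i (η, b) ∂A = t η) (η : H) : |t η| ≤ 1 := by
  rw [← ht 0, ← Real.norm_eq_abs]
  refine (norm_integral_le_of_norm_le_const (C := 1) (.of_forall fun b ↦ ?_)).trans (by simp)
  exact (sq_le_one_iff_abs_le_one _).1 (hsq 0 (η, b)).le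

/-- Averaging the conditional moments over the hash function, for a fixed number of users. -/
theorem moments_fixed_size (hv : ∀ i, Measurable (v i)) (hsq : ∀ i x, v i x ^ 2 = 1)
    (hi : ∀ η, iIndepFun (fun i b ↦ v i (η, b)) A)
    (ht : ∀ i η, ∫ b, v i (η, b) ∂A = t η) (n : ℕ) :
    ∫ x, (∑ i ∈ Finset.range n, v i x) ^ 2 ∂(ν.prod A) =
      n.descFactorial 1 + n.descFactorial 2 * ∫ η, t η ^ 2 ∂ν ∧
    ∫ x, (∑ i ∈ Finset.range n, v i x) ^ 4 ∂(ν.prod A) =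
      n.descFactorial 1 + n.descFactorial 2 * (4 * (∫ η, t η ^ 2 ∂ν) + 3) +
        n.descFactorial 3 * (6 * ∫ η, t η ^ 2 ∂ν) + n.descFactorial 4 * ∫ η, t η ^ 4 ∂ν := by
  have mt : Measurable t := measurable_mean_sign hv ht
  have it : ∀ k : ℕ, Integrable (fun η ↦ t η ^ k) ν := fun k ↦
    integrable_of_abs_le (by fun_prop) (c := 1) fun η ↦ by
      rw [abs_pow]; exact pow_le_one₀ (abs_nonneg _) (abs_mean_sign_le hsq ht η)
  have iS : ∀ k : ℕ, Integrable (fun x ↦ (∑ i ∈ Finset.range n, v i x) ^ k) (ν.prod A) :=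
    fun k ↦ integrable_of_abs_le (by fun_prop) (c := (n : ℝ) ^ k) fun x ↦ by
      rw [abs_pow]
      exact pow_le_pow_left₀ (abs_nonneg _) (abs_sum_range_le (fun i ↦ hsq i x) n) k
  have key := fun η ↦ moments_sum_signs (v := fun i b ↦ v i (η, b))
    (fun i ↦ (hv i).comp measurable_prodMk_left) (hi η) (fun i b ↦ hsq i (η, b))
    (fun i ↦ ht i η) n
  constructor
  · rw [integral_prod _ (iS 2)]
    simp_rw [fun η ↦ (key η).2.1]
    rw [integral_add (integrable_const _) ((it 2).const_mul _), integral_const_mul]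
    simp only [cast_descFactorial_succ, Nat.descFactorial_zero]
    simp [-mul_eq_mul_right_iff]
    ring
  · rw [integral_prod _ (iS 4)]
    simp_rw [fun η ↦ (key η).2.2.2]
    have e : ∀ η, (n : ℝ) + n * (n - 1) * (4 * t η ^ 2 + 3) +
        n * (n - 1) * (n - 2) * (6 * t η ^ 2) + n * (n - 1) * (n - 2) * (n - 3) * t η ^ 4 =
        (n + n * (n - 1) * 3) + (n * (n - 1) * 4 + n * (n - 1) * (n - 2) * 6) * t η ^ 2 +
          n * (n - 1) * (n - 2) * (n - 3) * t η ^ 4 := fun η ↦ by ring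
    simp_rw [e]
    rw [integral_add ((integrable_const _).fun_add ((it 2).const_mul _)) ((it 4).const_mul _),
      integral_add (integrable_const _) ((it 2).const_mul _), integral_const_mul,
      integral_const_mul]
    simp only [cast_descFactorial_succ, Nat.descFactorial_zero]
    simp
    ring

/-- The square of a sum of a Poisson number of signs that are independent and identically
distributed given `η`, when the conditional mean `t η` has second moment `c` and its fourth moment
is at most that of a centred Gaussian variable. -/
theorem group_moments (hN : Measurable N) (hNm : ρ.map N = poissonMeasure m)
    (hv : ∀ i, Measurable (v i)) (hsq : ∀ i x, v i x ^ 2 = 1)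
    (hi : ∀ η, iIndepFun (fun i b ↦ v i (η, b)) A)
    (ht : ∀ i η, ∫ b, v i (η, b) ∂A = t η) (hc : ∫ η, t η ^ 2 ∂ν = c)
    (hc' : ∫ η, t η ^ 4 ∂ν ≤ 3 * c ^ 2) :
    let V : Θ × H × B → ℝ := fun ω ↦ ∑ i ∈ Finset.range (N ω.1), v i ω.2
    MemLp (fun ω ↦ V ω ^ 2) 2 (ρ.prod (ν.prod A)) ∧
    ∫ ω, V ω ^ 2 ∂(ρ.prod (ν.prod A)) = m + m ^ 2 * c ∧
    Var[fun ω ↦ V ω ^ 2; ρ.prod (ν.prod A)] ≤ m + 4 * m ^ 2 * c + 2 * (m + m ^ 2 * c) ^ 2 := by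
  intro V
  have mV : Measurable V := measurable_sum_range (hN.comp measurable_fst)
    fun i ↦ (hv i).comp measurable_snd
  have iN : ∀ {f : ℕ → ℝ}, Integrable f (poissonMeasure m) → Integrable (fun θ ↦ f (N θ)) ρ :=
    fun {f} h ↦ by
      rw [← hNm] at h
      exact h.comp_measurable hN
  have eN : ∀ f : ℕ → ℝ, ∫ θ, f (N θ) ∂ρ = ∫ n, f n ∂(poissonMeasure m) := fun f ↦ by
    rw [← hNm, integral_map hN.aemeasurable (by fun_prop)]
  have i4 : Integrable (fun ω ↦ V ω ^ 4) (ρ.prod (ν.prod A)) := by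
    refine ((iN (integrable_poisson_pow_four m)).comp_fst (ν.prod A)).mono'
      (by fun_prop) (.of_forall fun ω ↦ ?_)
    rw [norm_pow]
    exact pow_le_pow_left₀ (abs_nonneg _) (abs_sum_range_le (fun i ↦ hsq i ω.2) _) 4
  have hL : MemLp (fun ω ↦ V ω ^ 2) 2 (ρ.prod (ν.prod A)) := by
    rw [memLp_two_iff_integrable_sq (by fun_prop)]
    refine i4.congr (.of_forall fun ω ↦ ?_)
    simp only; ring
  have i2 : Integrable (fun ω ↦ V ω ^ 2) (ρ.prod (ν.prod A)) := hL.integrable (by norm_num)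
  have d := fun k ↦ integrable_poisson_descFactorial m k
  have key := fun n ↦ moments_fixed_size (ν := ν) hv hsq hi ht n
  have e2 : ∫ ω, V ω ^ 2 ∂(ρ.prod (ν.prod A)) = m + m ^ 2 * c := by
    rw [integral_prod _ i2]
    simp only [V, (key _).1, hc]
    rw [eN (fun n ↦ (n.descFactorial 1 : ℝ) + n.descFactorial 2 * c),
      integral_add (d 1) ((d 2).mul_const c), integral_mul_const,
      integral_poisson_descFactorial, integral_poisson_descFactorial, pow_one]
  have e4 : ∫ ω, V ω ^ 4 ∂(ρ.prod (ν.prod A)) =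
      m + m ^ 2 * (4 * c + 3) + m ^ 3 * (6 * c) + m ^ 4 * ∫ η, t η ^ 4 ∂ν := by
    rw [integral_prod _ i4]
    simp only [V, (key _).2, hc]
    rw [eN (fun n ↦ (n.descFactorial 1 : ℝ) + n.descFactorial 2 * (4 * c + 3) +
        n.descFactorial 3 * (6 * c) + n.descFactorial 4 * ∫ η, t η ^ 4 ∂ν),
      integral_add (((d 1).fun_add ((d 2).mul_const _)).fun_add ((d 3).mul_const _))
        ((d 4).mul_const _),
      integral_add ((d 1).fun_add ((d 2).mul_const _)) ((d 3).mul_const _),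
      integral_add (d 1) ((d 2).mul_const _), integral_mul_const, integral_mul_const,
      integral_mul_const]
    simp_rw [integral_poisson_descFactorial]
    rw [pow_one]
  refine ⟨hL, e2, ?_⟩
  rw [variance_eq_sub hL]
  have e4' : ∫ ω, ((fun ω ↦ V ω ^ 2) ^ 2) ω ∂(ρ.prod (ν.prod A)) =
      ∫ ω, V ω ^ 4 ∂(ρ.prod (ν.prod A)) := by
    congr 1; ext ω; simp only [Pi.pow_apply]; ring
  rw [e4', e4, e2]
  have := mul_le_mul_of_nonneg_left hc' (by positivity : (0 : ℝ) ≤ (m : ℝ) ^ 4)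
  linarith

end GroupMoments

/-! ### Amplification by the median -/

/-- If the median is far from `c`, then so are at least half of the entries. -/
theorem le_two_mul_card_of_median_far {a : ℕ} [NeZero a] (v : Fin a → ℝ) {c e : ℝ}
    (h : e < |median v - c|) :
    a ≤ 2 * (Finset.univ.filter fun l ↦ e < |v l - c|).card := by
  classical
  have ha := NeZero.pos a
  have mono := Tuple.monotone_sort v
  set σ := Tuple.sort v with hσ
  set lo : Fin a := ⟨(a - 1) / 2, by omega⟩ with hlo
  set hi : Fin a := ⟨a / 2, by omega⟩ with hhi
  have hmed : median v = (v (σ lo) + v (σ hi)) / 2 := rfl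
  have hle : v (σ lo) ≤ v (σ hi) := mono (show lo ≤ hi by
    rw [Fin.le_def]; simp only [hlo, hhi]; omega)
  rcases lt_abs.1 h with h | h
  · have hsub : (Finset.Ici hi).map σ.toEmbedding ⊆
        Finset.univ.filter fun l ↦ e < |v l - c| := by
      intro l hl
      obtain ⟨i, hi', rfl⟩ := Finset.mem_map.1 hl
      have : v (σ hi) ≤ v (σ i) := mono (Finset.mem_Ici.1 hi')
      refine Finset.mem_filter.2 ⟨Finset.mem_univ _, lt_abs.2 (Or.inl ?_)⟩
      simp only [Equiv.coe_toEmbedding]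
      linarith
    have hc := Finset.card_le_card hsub
    rw [Finset.card_map, Fin.card_Ici] at hc
    simp only [hhi] at hc
    omega
  · have hsub : (Finset.Iic lo).map σ.toEmbedding ⊆
        Finset.univ.filter fun l ↦ e < |v l - c| := by
      intro l hl
      obtain ⟨i, hi', rfl⟩ := Finset.mem_map.1 hl
      have : v (σ i) ≤ v (σ lo) := mono (Finset.mem_Iic.1 hi')
      refine Finset.mem_filter.2 ⟨Finset.mem_univ _, lt_abs.2 (Or.inr ?_)⟩
      simp only [Equiv.coe_toEmbedding]
      linarith
    have hc := Finset.card_le_card hsub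
    rw [Finset.card_map, Fin.card_Iic] at hc
    simp only [hlo] at hc
    omega

theorem sqrt_three_div_two_le : √3 / 2 ≤ Real.exp (-(1 / 8)) := by
  have h : (3 / 4 : ℝ) ≤ Real.exp (-(1 / 8)) ^ 2 := by
    rw [← Real.exp_nat_mul]
    have := Real.add_one_le_exp (-(1 / 4) : ℝ)
    norm_num at this ⊢
    linarith
  refine le_of_sq_le_sq ?_ (Real.exp_pos _).le
  rw [div_pow, Real.sq_sqrt (by norm_num)]
  linarith

/-- The median of `a` independent estimates, each of which is far from `c` with probability at
most `1/4`, is far from `c` with probability at most `exp (-a/8)`. -/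
theorem median_tail {Ω : Type*} {mΩ : MeasurableSpace Ω} {μ : Measure Ω} {a : ℕ} [NeZero a]
    {X : Fin a → Ω → ℝ} (hX : ∀ l, Measurable (X l)) (hi : iIndepFun X μ) {c e : ℝ}
    (hq : ∀ l, μ.real {ω | e < |X l ω - c|} ≤ 1 / 4) :
    μ.real {ω | e < |median (fun l ↦ X l ω) - c|} ≤ Real.exp (-(a / 8)) := by
  have := hi.isProbabilityMeasure
  set s : ℝ := √3 with hs
  have s0 : 0 < s := by positivity
  have s2 : s ^ 2 = 3 := Real.sq_sqrt (by norm_num)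
  have s1 : 1 ≤ s := by nlinarith
  -- the weight of an estimate is `√3` if it is far from `c`, and `1/√3` otherwise
  set F : ℝ → ℝ := fun x ↦ s⁻¹ + {x : ℝ | e < |x - c|}.indicator (fun _ ↦ s - s⁻¹) x with hF
  have mset : MeasurableSet {x : ℝ | e < |x - c|} :=
    measurableSet_lt measurable_const (by fun_prop)
  have mF : Measurable F := measurable_const.add (measurable_const.indicator mset)
  have Fpos : ∀ x, 0 < F x := fun x ↦ by
    by_cases h : e < |x - c| <;> simp [hF, h, s0]
  have hE : ∀ l, ∫ ω, F (X l ω) ∂μ ≤ s / 2 := fun l ↦ by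
    have m' : MeasurableSet {ω | e < |X l ω - c|} := hX l mset
    have e1 : ∀ ω, F (X l ω) =
        s⁻¹ + {ω | e < |X l ω - c|}.indicator (fun _ ↦ s - s⁻¹) ω := fun ω ↦ rfl
    simp_rw [e1]
    rw [integral_add (integrable_const _) ((integrable_const _).indicator m'),
      integral_indicator_const _ m']
    have h1 : (0 : ℝ) ≤ s - s⁻¹ := by
      have : s⁻¹ ≤ 1 := inv_le_one_of_one_le₀ s1
      linarith
    have h2 := mul_le_mul_of_nonneg_right (hq l) h1
    have h3 : s⁻¹ = s / 3 := by rw [← s2]; field_simp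
    simp only [integral_const, probReal_univ, smul_eq_mul, one_mul]
    rw [h3] at h2 ⊢
    linarith
  -- independence turns the mean of the product of the weights into the product of the means
  have hprod : ∫ ω, ∏ l, F (X l ω) ∂μ ≤ (s / 2) ^ a := by
    rw [hi.integral_fun_prod_comp (f := fun _ ↦ F) (fun l ↦ (hX l).aemeasurable)
      (fun l ↦ mF.aestronglyMeasurable)]
    calc ∏ l, ∫ ω, F (X l ω) ∂μ ≤ ∏ _l : Fin a, s / 2 :=
          Finset.prod_le_prod (fun l _ ↦ integral_nonneg fun ω ↦ (Fpos _).le) fun l _ ↦ hE l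
      _ = (s / 2) ^ a := by simp [div_pow]
  have hF_le : ∀ x, F x ≤ s := fun x ↦ by
    have : s⁻¹ ≤ s := (inv_le_one_of_one_le₀ s1).trans s1
    by_cases h : e < |x - c| <;> simp [hF, h, this]
  have hint : Integrable (fun ω ↦ ∏ l, F (X l ω)) μ :=
    integrable_of_abs_le (by fun_prop) (c := s ^ a) fun ω ↦ by
      rw [abs_of_pos (Finset.prod_pos fun l _ ↦ Fpos _)]
      calc ∏ l, F (X l ω) ≤ ∏ _l : Fin a, s :=
            Finset.prod_le_prod (fun l _ ↦ (Fpos _).le) fun l _ ↦ hF_le _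
        _ = s ^ a := by simp
  -- if the median is far, at least half of the weights are `√3`, so that their product is `≥ 1`
  have hsub : {ω | e < |median (fun l ↦ X l ω) - c|} ⊆ {ω | 1 ≤ ∏ l, F (X l ω)} := by
    intro ω hω
    have hc := le_two_mul_card_of_median_far _ hω
    have e1 : ∏ l, F (X l ω) = ∏ l, if e < |X l ω - c| then s else s⁻¹ :=
      Finset.prod_congr rfl fun l _ ↦ by
        by_cases h : e < |X l ω - c| <;> simp [hF, h]
    have hcard := Finset.card_filter_add_card_filter_not (s := (Finset.univ : Finset (Fin a)))
      (fun l ↦ e < |X l ω - c|)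
    rw [Finset.card_univ, Fintype.card_fin] at hcard
    show 1 ≤ ∏ l, F (X l ω)
    rw [e1, Finset.prod_ite, Finset.prod_const, Finset.prod_const, inv_pow,
      ← div_eq_mul_inv, one_le_div (by positivity)]
    exact pow_le_pow_right₀ s1 (by omega)
  calc μ.real {ω | e < |median (fun l ↦ X l ω) - c|}
      ≤ μ.real {ω | 1 ≤ ∏ l, F (X l ω)} := measureReal_mono hsub
    _ ≤ ∫ ω, ∏ l, F (X l ω) ∂μ := by
        simpa using mul_meas_ge_le_integral_of_nonneg
          (.of_forall fun ω ↦ (Finset.prod_pos fun l _ ↦ Fpos _).le) hint 1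
    _ ≤ (s / 2) ^ a := hprod
    _ ≤ Real.exp (-(1 / 8)) ^ a :=
        pow_le_pow_left₀ (by positivity) sqrt_three_div_two_le a
    _ = Real.exp (-(a / 8)) := by rw [← Real.exp_nat_mul]; ring_nf

/-- Chebyshev's inequality for the mean of pairwise independent estimates. -/
theorem mean_tail {ι Ω : Type*} {mΩ : MeasurableSpace Ω} {μ : Measure Ω} [IsProbabilityMeasure μ]
    {X : ι → Ω → ℝ} (hL : ∀ j, MemLp (X j) 2 μ)
    (hi : Pairwise fun i j ↦ IndepFun (X i) (X j) μ) {c v e : ℝ} (he : 0 < e)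
    (hE : ∀ j, ∫ ω, X j ω ∂μ = c) (hV : ∀ j, Var[X j; μ] ≤ v) (S : Finset ι)
    (hS : 0 < S.card) :
    μ.real {ω | e < |1 / (S.card : ℝ) * ∑ j ∈ S, X j ω - c|} ≤ v / S.card / e ^ 2 := by
  set b : ℝ := (S.card : ℝ) with hb
  have b0 : 0 < b := Nat.cast_pos.2 hS
  set Y : Ω → ℝ := fun ω ↦ 1 / b * ∑ j ∈ S, X j ω with hY
  have hsum : MemLp (fun ω ↦ ∑ j ∈ S, X j ω) 2 μ := memLp_finsetSum S fun j _ ↦ hL j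
  have hYL : MemLp Y 2 μ := hsum.const_mul _
  have hYE : ∫ ω, Y ω ∂μ = c := by
    rw [hY, integral_const_mul,
      integral_finsetSum _ fun j _ ↦ (hL j).integrable (by norm_num)]
    simp only [hE, Finset.sum_const, nsmul_eq_mul, ← hb]
    field_simp
  have hYV : Var[Y; μ] ≤ v / b := by
    have h1 := IndepFun.variance_sum (s := S) (fun j _ ↦ hL j) (hi.set_pairwise _)
    have h2 : (∑ j ∈ S, X j) = fun ω ↦ ∑ j ∈ S, X j ω := by ext; simp
    have h3 : ∑ j ∈ S, Var[X j; μ] ≤ b * v := by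
      refine (Finset.sum_le_sum fun j _ ↦ hV j).trans ?_
      simp [hb]
    rw [hY, variance_const_mul, ← h2, h1]
    calc (1 / b) ^ 2 * ∑ j ∈ S, Var[X j; μ] ≤ (1 / b) ^ 2 * (b * v) := by gcongr
      _ = v / b := by field_simp
  have hcheb := meas_ge_le_variance_div_sq hYL he
  rw [hYE] at hcheb
  calc μ.real {ω | e < |Y ω - c|} ≤ μ.real {ω | e ≤ |Y ω - c|} :=
        measureReal_mono (Set.ofPred_subset_ofPred.2 fun ω h ↦ le_of_lt h)
    _ ≤ Var[Y; μ] / e ^ 2 :=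
        ENNReal.toReal_le_of_le_ofReal (div_nonneg (variance_nonneg _ _) (sq_nonneg _)) hcheb
    _ ≤ v / b / e ^ 2 := by gcongr

/-! ### Independence of the groups -/

instance : MeasurableSingletonClass ℤˣ where
  measurableSet_singleton u :=
    ⟨{(u : ℤ)}, measurableSet_singleton _, by ext; simp [Units.ext_iff]⟩

/-- Evaluation of a random table of signs at a random place, as a real number. -/
theorem measurable_sign_eval {Y : Type*} [MeasurableSpace Y] [Countable Y]
    [MeasurableSingletonClass Y] :
    Measurable fun x : (Y → ℤˣ) × Y ↦ ((x.1 x.2 : ℤ) : ℝ) :=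
  measurable_from_prod_countable_left fun y ↦
    (measurable_of_finite fun u : ℤˣ ↦ ((u : ℤ) : ℝ)).comp (measurable_pi_apply y)

theorem sign_sq (u : ℤˣ) : ((u : ℤ) : ℝ) ^ 2 = 1 := by
  rcases Int.units_eq_one_or u with rfl | rfl <;> simp

variable (P : Params) {k : ℕ} (p : PMF (Fin k))

instance : IsProbabilityMeasure (law P p) := by
  unfold law; infer_instance

/-- The random choices that concern group `j`: its size, the hash values of the strings that start
with `j`, and the salts and samples of its users. -/
def groupData (enc : Fin P.g × Fin P.r × Fin k → List Bool) (j : Fin P.g) (ω : Outcome P k) :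
    ℕ × (Fin P.r × Fin k → ℤˣ) × (ℕ → Fin P.r) × (ℕ → Fin k) :=
  (ω.1 j, fun y ↦ ω.2.1 (enc (j, y)), fun i ↦ ω.2.2.1 (j, i), fun i ↦ ω.2.2.2 (j, i))

/-- Sub-blocks of the coordinates of a product of copies of `τ`, picked out by an injective map,
are independent. -/
theorem iIndepFun_blocks {Y ι κ α : Type*} {mα : MeasurableSpace α} (τ : Measure α)
    [IsProbabilityMeasure τ] {enc : ι × κ → Y} (henc : Function.Injective enc) :
    iIndepFun (fun (j : ι) (x : Y → α) (i : κ) ↦ x (enc (j, i)))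
      (Measure.infinitePi fun _ : Y ↦ τ) :=
  iIndepFun_curry (X := fun j i (x : Y → α) ↦ x (enc (j, i))) (fun _ _ ↦ measurable_pi_apply _)
    ((iIndepFun_infinitePi (P := fun _ : Y ↦ τ) (X := fun _ x ↦ x)
      fun _ ↦ measurable_id).precomp (henc.comp (Equiv.sigmaEquivProd ι κ).injective))

theorem iIndepFun_groupData {enc : Fin P.g × Fin P.r × Fin k → List Bool}
    (henc : Function.Injective enc) : iIndepFun (groupData P enc) (law P p) := by
  have hN : iIndepFun (fun j (N : Fin P.g → ℕ) ↦ N j)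
      (Measure.pi fun _ : Fin P.g => poissonMeasure P.m) :=
    iIndepFun_pi (X := fun _ n ↦ n) fun _ ↦ aemeasurable_id
  exact iIndepFun_prodMk (fun j ↦ measurable_pi_apply j) (fun j ↦ by fun_prop) hN
    (iIndepFun_prodMk (fun j ↦ by fun_prop) (fun j ↦ by fun_prop)
      (iIndepFun_blocks _ henc)
      (iIndepFun_prodMk (fun j ↦ by fun_prop) (fun j ↦ by fun_prop)
        (iIndepFun_blocks _ Function.injective_id) (iIndepFun_blocks _ Function.injective_id)))

/-- The estimate `C_j` as a function of the random choices that concern group `j`. -/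
noncomputable def estimateOfData
    (d : ℕ × (Fin P.r × Fin k → ℤˣ) × (ℕ → Fin P.r) × (ℕ → Fin k)) : ℝ :=
  P.r * ((∑ i ∈ Finset.range d.1, ((d.2.1 (d.2.2.1 i, d.2.2.2 i) : ℤ) : ℝ)) ^ 2 - P.m) /
    (P.m : ℝ) ^ 2

theorem measurable_estimateOfData : Measurable (estimateOfData P (k := k)) := by
  have h : ∀ i : ℕ, Measurable
      fun d : ℕ × (Fin P.r × Fin k → ℤˣ) × (ℕ → Fin P.r) × (ℕ → Fin k) ↦
        ((d.2.1 (d.2.2.1 i, d.2.2.2 i) : ℤ) : ℝ) := fun i ↦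
    measurable_sign_eval.comp (by fun_prop :
      Measurable fun d : ℕ × (Fin P.r × Fin k → ℤˣ) × (ℕ → Fin P.r) × (ℕ → Fin k) ↦
        (d.2.1, (d.2.2.1 i, d.2.2.2 i)))
  have hS := measurable_sum_range measurable_fst h
  unfold estimateOfData
  exact (((hS.pow_const 2).sub_const _).const_mul _).div_const _

theorem measurable_groupData (enc : Fin P.g × Fin P.r × Fin k → List Bool) (j : Fin P.g) :
    Measurable (groupData P enc j) := by
  unfold groupData
  fun_prop

theorem groupEstimate_eq (enc : Fin P.g × Fin P.r × Fin k → List Bool) (j : Fin P.g) :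
    (fun ω ↦ groupEstimate P enc ω j) = estimateOfData P ∘ groupData P enc j := rfl

theorem measurable_groupEstimate (enc : Fin P.g × Fin P.r × Fin k → List Bool) (j : Fin P.g) :
    Measurable fun ω ↦ groupEstimate P enc ω j := by
  rw [groupEstimate_eq]
  exact (measurable_estimateOfData P).comp (measurable_groupData P enc j)

theorem iIndepFun_groupEstimate {enc : Fin P.g × Fin P.r × Fin k → List Bool}
    (henc : Function.Injective enc) :
    iIndepFun (fun j ω ↦ groupEstimate P enc ω j) (law P p) := by
  rw [show (fun j ω ↦ groupEstimate P enc ω j) = fun j ↦ estimateOfData P ∘ groupData P enc j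
    from funext (groupEstimate_eq P enc)]
  exact (iIndepFun_groupData P p henc).comp (fun _ ↦ estimateOfData P)
    fun _ ↦ measurable_estimateOfData P

theorem measurable_supergroupMean (enc : Fin P.g × Fin P.r × Fin k → List Bool)
    (sg : Fin P.g → Fin P.a) (l : Fin P.a) :
    Measurable fun ω ↦ supergroupMean P enc sg ω l :=
  (Finset.measurable_sum _ fun j _ ↦ measurable_groupEstimate P enc j).const_mul _

theorem iIndepFun_supergroupMean {enc : Fin P.g × Fin P.r × Fin k → List Bool}
    (henc : Function.Injective enc) (sg : Fin P.g → Fin P.a) :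
    iIndepFun (fun l ω ↦ supergroupMean P enc sg ω l) (law P p) := by
  have h := iIndepFun_curry
    (X := fun (l : Fin P.a) (j : {j // sg j = l}) ω ↦ groupEstimate P enc ω j)
    (fun _ j ↦ measurable_groupEstimate P enc j)
    ((iIndepFun_groupEstimate P p henc).precomp (Equiv.sigmaFiberEquiv sg).injective)
  have h' := h.comp (fun l (x : {j // sg j = l} → ℝ) ↦ 1 / (P.b : ℝ) * ∑ j, x j)
    fun l ↦ by fun_prop
  convert h' using 3 with l ω
  simp only [supergroupMean, Function.comp]
  congr 1
  exact (Finset.sum_subtype _ (by simp) _)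

/-! ### The estimate of one group -/

theorem integral_sign :
    ∫ u : ℤˣ, ((u : ℤ) : ℝ) ∂(PMF.uniformOfFintype ℤˣ).toMeasure = 0 := by
  rw [PMF.integral_eq_sum]
  simp [PMF.uniformOfFintype_apply]

theorem sum_toReal_eq_one : ∑ x, (p x).toReal = 1 := by
  rw [← ENNReal.toReal_sum fun x _ ↦ p.apply_ne_top x, ← tsum_fintype (L := .unconditional _),
    p.tsum_coe, ENNReal.toReal_one]

/-- The moments of the square of the sum `V_j`: conditional on the hash function, the values sent
in group `j` are independent signs whose mean is a Rademacher sum with weights `p_x / r`. -/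
theorem groupSum_moments {enc : Fin P.g × Fin P.r × Fin k → List Bool}
    (henc : Function.Injective enc) (j : Fin P.g) {c : ℝ} (hc : c = collisionProb p / P.r) :
    MemLp (fun ω ↦ groupSum P enc ω j ^ 2) 2 (law P p) ∧
    ∫ ω, groupSum P enc ω j ^ 2 ∂(law P p) = P.m + P.m ^ 2 * c ∧
    Var[fun ω ↦ groupSum P enc ω j ^ 2; law P p] ≤
      P.m + 4 * P.m ^ 2 * c + 2 * (P.m + P.m ^ 2 * c) ^ 2 := by
  have hr : (P.r : ℝ) ≠ 0 := by exact_mod_cast P.r_pos.ne'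
  set q : Fin P.r × Fin k → ℝ := fun y ↦ (p y.2).toReal / P.r with hq
  have hqc : ∑ y, q y ^ 2 = c := by
    rw [Fintype.sum_prod_type, hc]
    simp only [hq, div_pow, Finset.sum_const, Finset.card_univ, Fintype.card_fin, nsmul_eq_mul,
      collisionProb, ← Finset.sum_div]
    field_simp
  have hinj : Function.Injective fun y : Fin P.r × Fin k ↦ enc (j, y) := fun y y' h ↦ by
    simpa using henc h
  have hcoe : Measurable fun u : ℤˣ ↦ ((u : ℤ) : ℝ) := measurable_of_finite _
  obtain ⟨hr2, hr4⟩ := moments_rademacher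
    (μ := Measure.infinitePi fun _ : List Bool => (PMF.uniformOfFintype ℤˣ).toMeasure)
    (ε := fun y η ↦ ((η (enc (j, y)) : ℤ) : ℝ))
    (fun y ↦ hcoe.comp (measurable_pi_apply _))
    ((iIndepFun_infinitePi (X := fun _ (u : ℤˣ) ↦ ((u : ℤ) : ℝ)) fun _ ↦ hcoe).precomp hinj)
    (fun y η ↦ sign_sq _)
    (fun y ↦ by
      have hmp := measurePreserving_eval_infinitePi
        (fun _ : List Bool => (PMF.uniformOfFintype ℤˣ).toMeasure) (enc (j, y))
      have e := integral_map hmp.aemeasurable hcoe.aestronglyMeasurable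
      rw [hmp.map_eq, integral_sign] at e
      exact e.symm)
    q Finset.univ
  rw [hqc] at hr2 hr4
  refine group_moments (N := fun N : Fin P.g → ℕ ↦ N j)
    (v := fun i (x : (List Bool → ℤˣ) × (Fin P.g × ℕ → Fin P.r) × (Fin P.g × ℕ → Fin k)) ↦
      ((x.1 (enc (j, x.2.1 (j, i), x.2.2 (j, i))) : ℤ) : ℝ))
    (measurable_pi_apply j) (measurePreserving_eval _ j).map_eq (fun i ↦ ?_)
    (fun i x ↦ sign_sq _) (fun η ↦ ?_) (fun i η ↦ ?_) hr2 hr4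
  · exact (measurable_sign_eval (Y := Fin P.r × Fin k)).comp (by fun_prop :
      Measurable fun x : (List Bool → ℤˣ) × (Fin P.g × ℕ → Fin P.r) × (Fin P.g × ℕ → Fin k) ↦
        (fun y ↦ x.1 (enc (j, y)), (x.2.1 (j, i), x.2.2 (j, i))))
  -- given the hash function, the values sent by distinct users are independent
  · have hinj' : Function.Injective fun i : ℕ ↦ (j, i) := fun i i' h ↦ by simpa using h
    have hs := (iIndepFun_infinitePi
      (P := fun _ : Fin P.g × ℕ => (PMF.uniformOfFintype (Fin P.r)).toMeasure)
      (X := fun _ s ↦ s) fun _ ↦ measurable_id).precomp hinj'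
    have hx := (iIndepFun_infinitePi (P := fun _ : Fin P.g × ℕ => p.toMeasure)
      (X := fun _ s ↦ s) fun _ ↦ measurable_id).precomp hinj'
    exact (iIndepFun_prodMk (fun _ ↦ by fun_prop) (fun _ ↦ by fun_prop) hs hx).comp
      (fun _ y ↦ ((η (enc (j, y)) : ℤ) : ℝ)) fun _ ↦ measurable_of_finite _
  -- given the hash function, the mean of one value is the Rademacher sum
  · set f : Fin P.r × Fin k → ℝ := fun y ↦ ((η (enc (j, y)) : ℤ) : ℝ) with hf
    have hmp := (measurePreserving_eval_infinitePi
        (fun _ : Fin P.g × ℕ => (PMF.uniformOfFintype (Fin P.r)).toMeasure) (j, i)).prod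
      (measurePreserving_eval_infinitePi (fun _ : Fin P.g × ℕ => p.toMeasure) (j, i))
    have e := integral_map hmp.aemeasurable
      (measurable_of_finite f).aestronglyMeasurable
    rw [hmp.map_eq, integral_prod _ .of_finite] at e
    refine e.symm.trans ?_
    rw [PMF.integral_eq_sum, Fintype.sum_prod_type]
    refine Finset.sum_congr rfl fun s _ ↦ ?_
    rw [PMF.integral_eq_sum, Finset.smul_sum]
    refine Finset.sum_congr rfl fun x _ ↦ ?_
    simp [hq, hf, PMF.uniformOfFintype_apply]
    ring

theorem collisionProb_pos : 0 < collisionProb p := by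
  obtain ⟨x, -, hx⟩ := Finset.exists_ne_zero_of_sum_ne_zero
    (by rw [sum_toReal_eq_one p]; exact one_ne_zero)
  exact Finset.sum_pos' (fun i _ ↦ sq_nonneg _) ⟨x, Finset.mem_univ _, by positivity⟩

theorem collisionProb_le_one : collisionProb p ≤ 1 := by
  rw [← sum_toReal_eq_one p]
  refine Finset.sum_le_sum fun x _ ↦ pow_le_of_le_one ENNReal.toReal_nonneg ?_ two_ne_zero
  exact ENNReal.toReal_mono ENNReal.one_ne_top (p.coe_le_one x)

/-- The variance bound in terms of `r / m`, which is small compared with the collision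
probability. -/
theorem variance_bound_arith {r m C : ℝ} (hr : 1 ≤ r) (hC : 0 < C) (hC1 : C ≤ 1)
    (h : 5 * r ≤ m * C) :
    (r / m ^ 2) ^ 2 * (m + 4 * m ^ 2 * (C / r) + 2 * (m + m ^ 2 * (C / r)) ^ 2) ≤ 5 * C ^ 2 := by
  have hm : 0 < m := pos_of_mul_pos_left (by linarith) hC.le
  have hr0 : 0 < r := by linarith
  set u := r / m with hu
  have hu0 : 0 < u := div_pos hr0 hm
  have hu1 : u ≤ C / 5 := by
    rw [hu, div_le_div_iff₀ hm (by norm_num)]; linarith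
  have hmu : 1 / m ≤ u := div_le_div_of_nonneg_right hr hm.le
  have e : (r / m ^ 2) ^ 2 * (m + 4 * m ^ 2 * (C / r) + 2 * (m + m ^ 2 * (C / r)) ^ 2) =
      u ^ 2 * (1 / m) + 4 * u * C * (1 / m) + 2 * (u + C) ^ 2 := by
    rw [hu]; field_simp
  have h1 : u ^ 2 * (1 / m) ≤ u ^ 2 * u := by gcongr
  have h2 : 4 * u * C * (1 / m) ≤ 4 * u * C * u := by gcongr
  have h3 : u ^ 2 * u ≤ u ^ 2 * 1 := by gcongr; linarith
  have h4 : 4 * u * C * u ≤ 4 * u * 1 * u := by gcongr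
  have h5 : u ^ 2 ≤ (C / 5) ^ 2 := by gcongr
  have h6 : (u + C) ^ 2 ≤ (C / 5 + C) ^ 2 := by gcongr
  rw [e]
  nlinarith

theorem groupEstimate_moments {enc : Fin P.g × Fin P.r × Fin k → List Bool}
    (henc : Function.Injective enc) (h : 5 * (P.r : ℝ) ≤ P.m * collisionProb p) (j : Fin P.g) :
    MemLp (fun ω ↦ groupEstimate P enc ω j) 2 (law P p) ∧
    ∫ ω, groupEstimate P enc ω j ∂(law P p) = collisionProb p ∧
    Var[fun ω ↦ groupEstimate P enc ω j; law P p] ≤ 5 * collisionProb p ^ 2 := by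
  obtain ⟨hL, hE, hV⟩ := groupSum_moments P p henc j rfl
  have hC := collisionProb_pos p
  have hr1 : (1 : ℝ) ≤ P.r := by exact_mod_cast P.r_pos
  have hm : (0 : ℝ) < P.m := pos_of_mul_pos_left (by linarith) hC.le
  have e : (fun ω : Outcome P k ↦ groupEstimate P enc ω j) =
      fun ω ↦ (P.r / (P.m : ℝ) ^ 2) * (groupSum P enc ω j ^ 2 - P.m) := by
    ext ω; rw [groupEstimate]; ring
  have hi := hL.integrable (by norm_num)
  rw [e]
  refine ⟨(hL.sub (memLp_const _)).const_mul _, ?_, ?_⟩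
  · rw [integral_const_mul, integral_sub hi (integrable_const _), hE]
    simp only [integral_const, probReal_univ, smul_eq_mul, one_mul]
    field_simp
    ring
  · rw [variance_const_mul, variance_sub_const hL.1]
    exact (mul_le_mul_of_nonneg_left hV (sq_nonneg _)).trans
      (variance_bound_arith hr1 hC (collisionProb_le_one p) h)

/-! ### The accuracy of the mechanism -/

theorem b_pos : 0 < P.b :=
  Nat.ceil_pos.2 (div_pos (by norm_num) (pow_pos P.ε_pos 2))

theorem g_pos : 0 < P.g := Nat.mul_pos P.a_pos (b_pos P)

/-- The guarantee holds as soon as the expected group size is at least `5 r / C(p)`. -/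
theorem accuracy_of_group_size {enc : Fin P.g × Fin P.r × Fin k → List Bool}
    (henc : Function.Injective enc) {sg : Fin P.g → Fin P.a}
    (hsg : ∀ l, (Finset.univ.filter fun j => sg j = l).card = P.b)
    (h : 5 * (P.r : ℝ) ≤ P.m * collisionProb p) :
    1 - P.δ ≤ (law P p).real
      {ω | |estimate P enc sg ω - collisionProb p| ≤ P.ε * collisionProb p} := by
  have hC := collisionProb_pos p
  have hε := P.ε_pos
  have key := groupEstimate_moments P p henc h
  have hb : 20 / P.ε ^ 2 ≤ P.b := Nat.le_ceil _
  have hb0 : (0 : ℝ) < P.b := by exact_mod_cast b_pos P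
  have hbad : ∀ l, (law P p).real
      {ω | P.ε * collisionProb p < |supergroupMean P enc sg ω l - collisionProb p|} ≤ 1 / 4 := by
    intro l
    have ht := mean_tail (e := P.ε * collisionProb p) (fun j ↦ (key j).1)
      (fun i j hij ↦ (iIndepFun_groupEstimate P p henc).indepFun hij) (by positivity)
      (fun j ↦ (key j).2.1) (fun j ↦ (key j).2.2) (Finset.univ.filter fun j => sg j = l)
      (by rw [hsg]; exact b_pos P)
    rw [hsg] at ht
    refine ht.trans ?_
    rw [div_le_iff₀ (by positivity)] at hb
    rw [div_div, div_le_div_iff₀ (by positivity) (by norm_num)]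
    nlinarith [mul_le_mul_of_nonneg_left hb (sq_nonneg (collisionProb p))]
  have htail := median_tail (measurable_supergroupMean P enc sg)
    (iIndepFun_supergroupMean P p henc sg) hbad
  have hδ : Real.exp (-(P.a / 8)) ≤ P.δ := by
    have ha : 8 * Real.log (1 / P.δ) ≤ P.a := Nat.le_ceil _
    rw [one_div, Real.log_inv] at ha
    rw [← Real.le_log_iff_exp_le P.δ_pos]
    linarith
  have hcompl := measureReal_union_le (μ := law P p)
    {ω | P.ε * collisionProb p < |estimate P enc sg ω - collisionProb p|}
    {ω | |estimate P enc sg ω - collisionProb p| ≤ P.ε * collisionProb p}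
  have hset : {ω : Outcome P k | P.ε * collisionProb p < |estimate P enc sg ω - collisionProb p|} ∪
      {ω | |estimate P enc sg ω - collisionProb p| ≤ P.ε * collisionProb p} = Set.univ :=
    Set.eq_univ_of_forall fun ω ↦ by simp [lt_or_ge]
  rw [hset, probReal_univ] at hcompl
  have htail' : (law P p).real
      {ω | P.ε * collisionProb p < |estimate P enc sg ω - collisionProb p|} ≤ P.δ :=
    htail.trans hδ
  linarith

theorem one_le_privFactor : 1 ≤ P.privFactor := by
  have h : 1 < Real.exp P.α := Real.one_lt_exp_iff.2 P.α_pos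
  exact (one_le_div (by linarith)).2 (by linarith)

/-- For `β` and `δ` bounded away from `1`, the ceilings and the factor `4` in `log (4/β)` are
absorbed by the constant. -/
theorem exists_const_group_size {β₀ δ₀ : ℝ} (hβ₀ : β₀ < 1) (hδ₀ : δ₀ < 1) :
    ∃ K : ℝ, 0 < K ∧ ∀ (P : Params) (C : ℝ), 0 < C → P.β ≤ β₀ → P.δ ≤ δ₀ →
      K * (P.privFactor ^ 2 * (Real.log (1 / P.β) * Real.log (1 / P.δ) / (C * P.ε ^ 2))) ≤ P.n →
      5 * (P.r : ℝ) ≤ P.m * C := by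
  by_cases h0 : 0 < β₀ ∧ 0 < δ₀
  swap
  -- no `P` satisfies `P.β ≤ β₀` and `P.δ ≤ δ₀`
  · refine ⟨1, one_pos, fun P C _ h1 h2 ↦ (h0 ⟨?_, ?_⟩).elim⟩
    · exact P.β_pos.trans_le h1
    · exact P.δ_pos.trans_le h2
  obtain ⟨hβ0, hδ0⟩ := h0
  set B := Real.log (1 / β₀) with hB
  set D := Real.log (1 / δ₀) with hD
  have B0 : 0 < B := Real.log_pos ((one_lt_div hβ0).2 hβ₀)
  have D0 : 0 < D := Real.log_pos ((one_lt_div hδ0).2 hδ₀)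
  have L4 : 0 < Real.log 4 := Real.log_pos (by norm_num)
  -- the factors bound `5`, `r / (F² log (1/β))`, `a / log (1/δ)` and `b ε²`, where `F` is the
  -- privacy factor; the summands `1/B` and `1/D` pay for the ceilings in `r` and `a`
  refine ⟨5 * (6 * (Real.log 4 / B + 1) + 1 / B) * (8 + 1 / D) * 21, by positivity, ?_⟩
  intro P C hC hβ hδ hn
  set Lβ := Real.log (1 / P.β) with hLβ
  set Lδ := Real.log (1 / P.δ) with hLδ
  have hBL : B ≤ Lβ := Real.log_le_log (by positivity) (one_div_le_one_div_of_le P.β_pos hβ)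
  have hDL : D ≤ Lδ := Real.log_le_log (by positivity) (one_div_le_one_div_of_le P.δ_pos hδ)
  have hB1 : 1 ≤ Lβ / B := (one_le_div B0).2 hBL
  have hD1 : 1 ≤ Lδ / D := (one_le_div D0).2 hDL
  have hLβ0 : 0 < Lβ := B0.trans_le hBL
  have hLδ0 : 0 < Lδ := D0.trans_le hDL
  have hF := one_le_privFactor P
  have hF2 : 1 ≤ P.privFactor ^ 2 := one_le_pow₀ hF
  have hε := P.ε_pos
  have hε2 : P.ε ^ 2 ≤ 1 := pow_le_one₀ hε.le P.ε_le
  have hlog : Real.log (4 / P.β) = Real.log 4 + Lβ := by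
    rw [hLβ, ← Real.log_mul (by norm_num) (by have := P.β_pos; positivity), mul_one_div]
  have hr : (P.r : ℝ) ≤ (6 * (Real.log 4 / B + 1) + 1 / B) * (P.privFactor ^ 2 * Lβ) := by
    have h1 : (P.r : ℝ) < 6 * P.privFactor ^ 2 * Real.log (4 / P.β) + 1 :=
      Nat.ceil_lt_add_one (by rw [hlog]; positivity)
    have h2 : Real.log 4 ≤ Real.log 4 * (Lβ / B) := le_mul_of_one_le_right L4.le hB1
    have h3 : 1 ≤ P.privFactor ^ 2 * (Lβ / B) := one_le_mul_of_one_le_of_one_le hF2 hB1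
    have h4 : 6 * P.privFactor ^ 2 * Real.log (4 / P.β) ≤
        6 * P.privFactor ^ 2 * (Real.log 4 * (Lβ / B) + Lβ) := by
      rw [hlog]; gcongr
    calc (P.r : ℝ) ≤ 6 * P.privFactor ^ 2 * (Real.log 4 * (Lβ / B) + Lβ) +
          P.privFactor ^ 2 * (Lβ / B) := by linarith
      _ = _ := by ring
  have ha : (P.a : ℝ) ≤ (8 + 1 / D) * Lδ := by
    have h1 : (P.a : ℝ) < 8 * Real.log (1 / P.δ) + 1 := Nat.ceil_lt_add_one (by positivity)
    calc (P.a : ℝ) ≤ 8 * Lδ + Lδ / D := by linarith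
      _ = _ := by ring
  have hb : (P.b : ℝ) ≤ 21 / P.ε ^ 2 := by
    have h1 : (P.b : ℝ) < 20 / P.ε ^ 2 + 1 := Nat.ceil_lt_add_one (by positivity)
    have h2 : 1 ≤ 1 / P.ε ^ 2 := (one_le_div (by positivity)).2 hε2
    calc (P.b : ℝ) ≤ 20 / P.ε ^ 2 + 1 / P.ε ^ 2 := by linarith
      _ = _ := by ring
  have hg : (P.g : ℝ) = P.a * P.b := by rw [Params.g]; push_cast; ring
  have hg0 : (0 : ℝ) < P.g := by exact_mod_cast g_pos P
  have hprod : 5 * (P.r : ℝ) * P.g / C ≤ P.n := by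
    refine le_trans ?_ hn
    rw [hg]
    calc 5 * (P.r : ℝ) * (P.a * P.b) / C
        ≤ 5 * ((6 * (Real.log 4 / B + 1) + 1 / B) * (P.privFactor ^ 2 * Lβ)) *
          (((8 + 1 / D) * Lδ) * (21 / P.ε ^ 2)) / C := by gcongr
      _ = _ := by field_simp
  have hm : (P.m : ℝ) = P.n / P.g := by simp [Params.m]
  rw [hm, div_mul_eq_mul_div, le_div_iff₀ hg0]
  exact (div_le_iff₀ hC).1 hprod

/-! ### The number of users -/

theorem measurePreserving_groupSize (j : Fin P.g) :
    MeasurePreserving (fun ω : Outcome P k ↦ ω.1 j) (law P p) (poissonMeasure P.m) :=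
  (measurePreserving_eval (fun _ : Fin P.g => poissonMeasure P.m) j).comp measurePreserving_fst

theorem numUsers_integral :
    Integrable (fun ω => (numUsers P ω : ℝ)) (law P p) ∧
      ∫ ω, (numUsers P ω : ℝ) ∂(law P p) = P.n := by
  have e : ∀ ω : Outcome P k, (numUsers P ω : ℝ) = ∑ j, (ω.1 j : ℝ) := fun ω ↦ by
    simp [numUsers]
  have hi : ∀ j, Integrable (fun ω : Outcome P k ↦ (ω.1 j : ℝ)) (law P p) := fun j ↦ by
    have h := (measurePreserving_groupSize P p j).integrable_comp_of_integrable
      (integrable_poisson_descFactorial P.m 1)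
    simpa [Function.comp_def] using h
  have hE : ∀ j, ∫ ω : Outcome P k, (ω.1 j : ℝ) ∂(law P p) = P.m := fun j ↦ by
    have hmp := measurePreserving_groupSize P p j
    have h := integral_map hmp.aemeasurable (f := fun n : ℕ ↦ (n.descFactorial 1 : ℝ))
      (by fun_prop)
    rw [hmp.map_eq, integral_poisson_descFactorial] at h
    simpa using h.symm
  simp_rw [e]
  refine ⟨integrable_finsetSum _ fun j _ ↦ hi j, ?_⟩
  have hg0 : (P.g : ℝ) ≠ 0 := by exact_mod_cast (g_pos P).ne'
  rw [integral_finsetSum _ fun j _ ↦ hi j]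
  simp only [hE, Finset.sum_const, Finset.card_univ, Fintype.card_fin, nsmul_eq_mul, Params.m]
  push_cast
  field_simp

end CollisionMech

open CollisionMech in
theorem theorem2 :
    (∀ (P : Params) (k : ℕ) (p : PMF (Fin k)),
      Integrable (fun ω => (numUsers P ω : ℝ)) (law P p) ∧
        ∫ ω, (numUsers P ω : ℝ) ∂(law P p) = P.n) ∧
    (∀ β₀ < (1 : ℝ), ∀ δ₀ < (1 : ℝ), ∃ K : ℝ, 0 < K ∧
      ∀ (P : Params) (k : ℕ) (p : PMF (Fin k))
        (enc : Fin P.g × Fin P.r × Fin k → List Bool) (sg : Fin P.g → Fin P.a),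
        Function.Injective enc →
        (∀ l, (Finset.univ.filter fun j => sg j = l).card = P.b) →
        P.β ≤ β₀ → P.δ ≤ δ₀ →
        K * (((Real.exp P.α + 1) / (Real.exp P.α - 1)) ^ 2 *
          (Real.log (1 / P.β) * Real.log (1 / P.δ) / (collisionProb p * P.ε ^ 2))) ≤ P.n →
        1 - P.δ ≤ (law P p).real
          {ω | |estimate P enc sg ω - collisionProb p| ≤ P.ε * collisionProb p}) := by
  refine ⟨numUsers_integral, fun β₀ hβ₀ δ₀ hδ₀ ↦ ?_⟩
  obtain ⟨K, hK, h⟩ := exists_const_group_size hβ₀ hδ₀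
  exact ⟨K, hK, fun P k p enc sg henc hsg hβ hδ hn ↦
    accuracy_of_group_size P p henc hsg (h P _ (collisionProb_pos p) hβ hδ hn)⟩
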